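/- Let $\mathbb{T}^3=\mathbb{R}^3/\mathbb{Z}^3$ with coordinate vector fields $\partial_i$ and one-forms $dx^i$. *Fournodavlos and Luk initial data on the singularity* are smooth functions $c_{ij},p_i:\mathbb{T}^3\to\mathbb{R}$, $i,j=1,2,3$, with $c_{ij}=c_{ji}$, $p_1<p_2<p_3$, $c_{11},c_{22},c_{33}>0$, $\sum_i p_i=\sum_i p_i^2=1$ and, for $i=1,2,3$, $$\sum_{l=1}^{3}\Big[\frac{\partial_i c_{ll}}{c_{ll}}(p_l-p_i)+2\,\partial_l\kappa_i{}^l+\mathbb{1}_{\{l>i\}}\frac{\partial_l(c_{11}c_{22}c_{33})}{c_{11}c_{22}c_{33}}\,\kappa_i{}^l\Big]=0,$$ where $\kappa_i{}^i=-p_i$ (no summation), $\kappa_i{}^l=0$ if $l<i$, and $$\kappa_1{}^2=(p_1-p_2)\frac{c_{12}}{c_{22}},\quad \kappa_2{}^3=(p_2-p_3)\frac{c_{23}}{c_{33}},\quad \kappa_1{}^3=(p_2-p_1)\frac{c_{12}c_{23}}{c_{22}c_{33}}+(p_1-p_3)\frac{c_{13}}{c_{33}}.$$ Let $\bar M$ be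 a smooth $3$-dimensional manifold, $\bar h$ a smooth Riemannian metric on $\bar M$ and $\mathcal{K}$ a smooth $(1,1)$-tensor field on $\bar M$. Then $(\bar M,\bar h,\mathcal{K})$ are *non-degenerate quiescent vacuum initial data on the singularity* if 1. $\operatorname{tr}\mathcal{K}=1$ and $\bar h(\mathcal{K}\xi,\zeta)=\bar h(\xi,\mathcal{K}\zeta)$ for all $x\in\bar M$ and $\xi,\zeta\in T_x\bar M$; 2. $\operatorname{tr}\mathcal{K}^2=1$ and $\operatorname{div}_{\bar h}\mathcal{K}=0$, where $(\operatorname{div}_{\bar h}\mathcal{K})_j=\nabla_i\mathcal{K}_j{}^i$ and $\nabla$ is the Levi-Civita connection of $\bar h$; 3. at every point the eigenvalues of $\mathcal{K}$ are distinct; 4. $\mathcal{O}^1_{23}\equiv 0$ on $\bar M$, where $\mathcal{O}^A_{BC}:=(\gamma^A_{BC})^2$; here $q_1<q_2<q_3$ are the eigenvalues of $\mathcal{K}$, $\mathcal{X}_A$ are (local, smooth) eigenvector fields with $\mathcal{K}\mathcal{X}_A=q_A\mathcal{X}_A$ and $|\mathcal{X}_A|_{\bar h}=1$, which are unique up to sign,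 and $[\mathcal{X}_B,\mathcal{X}_C]=\sum_A\gamma^A_{BC}\mathcal{X}_A$. **Proposition.** Given Fournodavlos and Luk initial data $(c_{ij},p_i)$ on $\mathbb{T}^3$, let $\mathcal{K}$ be the $(1,1)$-tensor field with $\mathcal{K}\partial_i=\sum_j\mathcal{K}_i{}^j\partial_j$, $\mathcal{K}_i{}^j=-\kappa_i{}^j$, and let $\bar h=\sum_{A=1}^{3}c_{AA}\,\mathcal{Y}^A\otimes\mathcal{Y}^A$, where $$\mathcal{Y}^1=dx^1,\quad \mathcal{Y}^2=dx^2-a\,dx^1,\quad \mathcal{Y}^3=dx^3-b\,dx^2+(ab-d)\,dx^1,$$ $$a=\frac{\mathcal{K}_1{}^2}{p_1-p_2},\quad b=\frac{\mathcal{K}_2{}^3}{p_2-p_3},\quad d=\frac{1}{p_1-p_3}\Big(\mathcal{K}_1{}^3+\frac{1}{p_1-p_2}\mathcal{K}_1{}^2\mathcal{K}_2{}^3\Big).$$ Then $(\mathbb{T}^3,\bar h,\mathcal{K})$ are non-degenerate quiescent vacuum initial data on the singularity; in particular $\bar h$ is a smooth Riemannian metric and $\mathcal{K}$ is a smooth $(1,1)$-tensor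 field. -/

import Mathlib

open Set Filter Topology Manifold Bundle
open scoped ContDiff

noncomputable section

/-- The model space `ℝ³`. -/
abbrev E3 : Type := EuclideanSpace ℝ (Fin 3)

/-! ### The torus `𝕋³ = (ℝ/ℤ)³` as a smooth manifold -/

/-- The three-torus `(ℝ/ℤ)³`. -/
abbrev T3 : Type := Fin 3 → UnitAddCircle

namespace T3

/-- The covering projection `ℝ³ → 𝕋³`. -/
def proj (u : E3) : T3 := fun i => ((u i : ℝ) : UnitAddCircle)

theorem isLocalHomeomorph_proj : IsLocalHomeomorph proj := by
  refine IsLocalHomeomorph.mk proj fun u => ?_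
  refine ⟨(EuclideanSpace.equiv (Fin 3) ℝ).toHomeomorph.toOpenPartialHomeomorph.trans
    (OpenPartialHomeomorph.pi fun i =>
      AddCircle.openPartialHomeomorphCoe (1 : ℝ) (u i - 1 / 2)), ?_, ?_⟩
  · simp only [OpenPartialHomeomorph.trans_source, OpenPartialHomeomorph.pi]
    refine ⟨trivial, fun i _ => ?_⟩
    change u i ∈ Ioo _ _
    constructor <;> linarith
  · intro v _
    rfl

theorem surjective_proj : Function.Surjective proj := by
  intro x
  choose v hv using fun i => QuotientAddGroup.mk_surjective (x i)
  exact ⟨WithLp.toLp 2 v, funext hv⟩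

/-- The charts of `𝕋³` are local inverses of the covering projection. -/
instance : ChartedSpace E3 T3 := isLocalHomeomorph_proj.chartedSpace surjective_proj

theorem proj_chart_symm {e : OpenPartialHomeomorph T3 E3} (he : e ∈ atlas E3 T3) (y : E3) :
    e.symm y = proj y := by
  obtain ⟨q, rfl⟩ := he
  simp only [OpenPartialHomeomorph.trans_symm_eq_symm_trans_symm, OpenPartialHomeomorph.trans_apply,
    IsLocalHomeomorph.localInverseAt_symm]
  rfl

/-- A continuous local map covering the identity of `𝕋³` is locally a translation. -/
theorem eventually_translation {f : E3 → E3} {s : Set E3} (hs : IsOpen s)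
    (hf : ContinuousOn f s) (hp : ∀ y ∈ s, proj (f y) = proj y) {u : E3} (hu : u ∈ s) :
    ∀ᶠ y in 𝓝 u, f y = y + (f u - u) := by
  have hc : ContinuousAt (fun y => f y - y) u :=
    (hf.continuousAt (hs.mem_nhds hu)).sub continuousAt_id
  have hb : ∀ᶠ y in 𝓝 u, dist (f y - y) (f u - u) < 1 :=
    hc.eventually (Metric.ball_mem_nhds _ one_pos)
  filter_upwards [hb, hs.mem_nhds hu] with y hy hys
  have key : ∀ w ∈ s, ∀ i, ∃ n : ℤ, (f w - w) i = n := by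
    intro w hw i
    have h1 : ((f w i : ℝ) : UnitAddCircle) = ((w i : ℝ) : UnitAddCircle) := congrFun (hp w hw) i
    have h2 : ((f w i - w i : ℝ) : UnitAddCircle) = 0 := by
      rw [AddCircle.coe_sub, h1, sub_self]
    obtain ⟨n, hn⟩ := (AddCircle.coe_eq_zero_iff (1 : ℝ)).1 h2
    exact ⟨n, by simpa using hn.symm⟩
  have hz : f y - y = f u - u := by
    ext i
    obtain ⟨m, hm⟩ := key y hys i
    obtain ⟨n, hn⟩ := key u hu i
    have hle : |(f y - y) i - (f u - u) i| < 1 := by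
      refine lt_of_le_of_lt ?_ hy
      have := PiLp.dist_apply_le (f y - y) (f u - u) i
      rwa [Real.dist_eq] at this
    rw [hm, hn] at hle ⊢
    have hlt : |m - n| < 1 := by
      rw [← Int.cast_lt (R := ℝ)]
      push_cast
      exact hle
    have : m - n = 0 := Int.abs_lt_one_iff.1 hlt
    have : m = n := by omega
    rw [this]
  rw [← hz]
  abel

instance : IsManifold (𝓡 3) ∞ T3 := by
  refine isManifold_of_contDiffOn (𝓡 3) ∞ T3 fun e e' he he' => ?_
  simp only [modelWithCornersSelf_coe, modelWithCornersSelf_coe_symm, Function.comp_id,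
    Function.id_comp, preimage_id, range_id, inter_univ]
  intro u hu
  have hs : IsOpen (e.symm.trans e').source := (e.symm.trans e').open_source
  have hev := eventually_translation hs (e.symm.trans e').continuousOn (fun y hy => by
    have h2 : e.symm y ∈ e'.source := by
      have := hy
      rw [OpenPartialHomeomorph.trans_source] at this
      exact this.2
    rw [← proj_chart_symm he', OpenPartialHomeomorph.trans_apply, e'.left_inv h2,
      proj_chart_symm he]) hu
  refine ContDiffAt.contDiffWithinAt ?_
  refine ContDiffAt.congr_of_eventuallyEq (f := fun y => y + ((e.symm.trans e') u - u)) ?_ hev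
  fun_prop

/-- The coordinate vector field `∂ᵢ` on `𝕋³`. Charts of `𝕋³` are local inverses of `proj`, so that
`T_x 𝕋³` is identified with `ℝ³` by `d proj`; see `hasMFDerivAt_proj`. -/
def coordField (i : Fin 3) (x : T3) : TangentSpace (𝓡 3) x := EuclideanSpace.single i (1 : ℝ)

/-- The coordinate one-form `dxⁱ` on `𝕋³`. -/
def dx (i : Fin 3) (x : T3) : TangentSpace (𝓡 3) x →L[ℝ] ℝ :=
  (EuclideanSpace.proj i : E3 →L[ℝ] ℝ)

/-- Under the identification of the tangent spaces of `𝕋³` with `ℝ³`, the covering projection has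
derivative the identity; in particular `d proj (eᵢ) = ∂ᵢ`. -/
theorem hasMFDerivAt_proj (u : E3) :
    HasMFDerivAt 𝓘(ℝ, E3) (𝓡 3) proj u (ContinuousLinearMap.id ℝ E3) := by
  refine ⟨isLocalHomeomorph_proj.continuous.continuousAt, ?_⟩
  change HasFDerivWithinAt (fun y : E3 => chartAt E3 (proj u) (proj y))
    (ContinuousLinearMap.id ℝ E3) (range fun y : E3 => y) u
  rw [show (range fun y : E3 => y) = univ from range_id, hasFDerivWithinAt_univ]
  set e := chartAt E3 (proj u) with he
  have hs : IsOpen (proj ⁻¹' e.source) := e.open_source.preimage isLocalHomeomorph_proj.continuous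
  have hcont : ContinuousOn (fun y => e (proj y)) (proj ⁻¹' e.source) :=
    e.continuousOn.comp isLocalHomeomorph_proj.continuous.continuousOn fun _ h => h
  have hev := eventually_translation hs hcont (fun y hy => by
    rw [← proj_chart_symm (chart_mem_atlas E3 (proj u)), e.left_inv hy])
    (mem_chart_source E3 (proj u))
  have h1 : HasFDerivAt (fun y : E3 => y + (e (proj u) - u)) (ContinuousLinearMap.id ℝ E3) u :=
    (hasFDerivAt_id u).add_const _
  exact h1.congr_of_eventuallyEq hev

/-- The partial derivative `∂ᵢ f` of a function on `𝕋³`. -/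
def partialDeriv (i : Fin 3) (f : T3 → ℝ) (x : T3) : ℝ :=
  mfderiv (𝓡 3) 𝓘(ℝ, ℝ) f x (coordField i x)

end T3

/-! ### Non-degenerate quiescent vacuum initial data on the singularity -/

section Data

variable {M : Type*} [TopologicalSpace M] [ChartedSpace E3 M]

/-- The `i`-th coordinate vector field of the preferred chart at `x₀`, at the point with
coordinates `y`. -/
def chartVec (x₀ : M) (i : Fin 3) (y : E3) :
    TangentSpace (𝓡 3) ((extChartAt (𝓡 3) x₀).symm y) :=
  mfderiv 𝓘(ℝ, E3) (𝓡 3) (extChartAt (𝓡 3) x₀).symm y (EuclideanSpace.single i (1 : ℝ))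

/-- The components `h_{ij}` of a `(0,2)`-tensor field in the preferred chart at `x₀`. -/
def metricCoord (h : ∀ x : M, TangentSpace (𝓡 3) x →L[ℝ] TangentSpace (𝓡 3) x →L[ℝ] ℝ)
    (x₀ : M) (y : E3) : Matrix (Fin 3) (Fin 3) ℝ :=
  Matrix.of fun i j => h ((extChartAt (𝓡 3) x₀).symm y) (chartVec x₀ i y) (chartVec x₀ j y)

/-- The components `K_j{}^i` of a `(1,1)`-tensor field in the preferred chart at `x₀`, that is
`K ∂_j = ∑ i, K_j{}^i ∂_i`; the arguments are `j` (lower index), then `i` (upper index). -/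
def endoCoord (K : ∀ x : M, TangentSpace (𝓡 3) x →L[ℝ] TangentSpace (𝓡 3) x)
    (x₀ : M) (j i : Fin 3) (y : E3) : ℝ :=
  (EuclideanSpace.proj i : E3 →L[ℝ] ℝ)
    (mfderiv (𝓡 3) 𝓘(ℝ, E3) (extChartAt (𝓡 3) x₀) ((extChartAt (𝓡 3) x₀).symm y)
      (K ((extChartAt (𝓡 3) x₀).symm y) (chartVec x₀ j y)))

/-- The partial derivative `∂ᵢ f` of a function on `ℝ³`. -/
def pderivE3 (i : Fin 3) (f : E3 → ℝ) (y : E3) : ℝ :=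
  fderiv ℝ f y (EuclideanSpace.single i (1 : ℝ))

/-- The Christoffel symbols `Γ^k_{ij}` of the Levi-Civita connection of `h`, in the preferred chart
at `x₀`. -/
def christoffel (h : ∀ x : M, TangentSpace (𝓡 3) x →L[ℝ] TangentSpace (𝓡 3) x →L[ℝ] ℝ)
    (x₀ : M) (k i j : Fin 3) (y : E3) : ℝ :=
  (1 / 2) * ∑ l, (metricCoord h x₀ y)⁻¹ k l *
    (pderivE3 i (fun z => metricCoord h x₀ z j l) y
      + pderivE3 j (fun z => metricCoord h x₀ z i l) y
      - pderivE3 l (fun z => metricCoord h x₀ z i j) y)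

/-- The component `(div_h K)_j = ∇_i K_j{}^i = ∂_i K_j{}^i + Γ^i_{ik} K_j{}^k - Γ^k_{ij} K_k{}^i`
at `x₀` of the divergence of a `(1,1)`-tensor field, with respect to the coordinate frame at `x₀` of
the preferred chart at `x₀`. -/
def divergence (h : ∀ x : M, TangentSpace (𝓡 3) x →L[ℝ] TangentSpace (𝓡 3) x →L[ℝ] ℝ)
    (K : ∀ x : M, TangentSpace (𝓡 3) x →L[ℝ] TangentSpace (𝓡 3) x) (x₀ : M) (j : Fin 3) : ℝ :=
  let y₀ := extChartAt (𝓡 3) x₀ x₀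
  ∑ i, (pderivE3 i (endoCoord K x₀ j i) y₀
    + ∑ k, (christoffel h x₀ i i k y₀ * endoCoord K x₀ j k y₀
      - christoffel h x₀ k i j y₀ * endoCoord K x₀ k i y₀))

variable [IsManifold (𝓡 3) ∞ M]

/-- `h` is a smooth Riemannian metric on `M`. -/
def IsSmoothRiemannianMetric
    (h : ∀ x : M, TangentSpace (𝓡 3) x →L[ℝ] TangentSpace (𝓡 3) x →L[ℝ] ℝ) : Prop :=
  ∃ g : ContMDiffRiemannianMetric (𝓡 3) ∞ E3 (fun x : M => TangentSpace (𝓡 3) x),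
    ∀ x, g.inner x = h x

/-- `K` is a smooth `(1,1)`-tensor field on `M`. -/
def IsSmoothEndoField (K : ∀ x : M, TangentSpace (𝓡 3) x →L[ℝ] TangentSpace (𝓡 3) x) : Prop :=
  ContMDiff (𝓡 3) ((𝓡 3).prod 𝓘(ℝ, E3 →L[ℝ] E3)) ∞
    (fun x => TotalSpace.mk' (E3 →L[ℝ] E3)
      (E := fun x : M => TangentSpace (𝓡 3) x →L[ℝ] TangentSpace (𝓡 3) x) x (K x))

/-- On the set `U`, `X₀, X₁, X₂` are smooth `h`-unit eigenvector fields of `K`, with eigenvalues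
`p₀ < p₁ < p₂`. -/
structure IsUnitEigenframeOn
    (h : ∀ x : M, TangentSpace (𝓡 3) x →L[ℝ] TangentSpace (𝓡 3) x →L[ℝ] ℝ)
    (K : ∀ x : M, TangentSpace (𝓡 3) x →L[ℝ] TangentSpace (𝓡 3) x)
    (U : Set M) (p : Fin 3 → M → ℝ) (X : Fin 3 → ∀ x : M, TangentSpace (𝓡 3) x) : Prop where
  smooth : ∀ A, ContMDiffOn (𝓡 3) ((𝓡 3).prod 𝓘(ℝ, E3)) ∞
    (fun x => (⟨x, X A x⟩ : TangentBundle (𝓡 3) M)) U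
  eigen : ∀ x ∈ U, ∀ A, K x (X A x) = p A x • X A x
  unit : ∀ x ∈ U, ∀ A, h x (X A x) (X A x) = 1
  ordered : ∀ x ∈ U, StrictMono fun A => p A x

/-- `γ A B C` are the structure coefficients `γ^A_{BC}` of the frame `X` on `U`:
`[X_B, X_C] = ∑ A, γ^A_{BC} X_A`. -/
def IsStructureCoeffOn (U : Set M) (X : Fin 3 → ∀ x : M, TangentSpace (𝓡 3) x)
    (γ : Fin 3 → Fin 3 → Fin 3 → M → ℝ) : Prop :=
  ∀ x ∈ U, ∀ B C, VectorField.mlieBracket (𝓡 3) (X B) (X C) x = ∑ A, γ A B C x • X A x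

/-- Non-degenerate quiescent vacuum initial data on the singularity. Indices `1, 2, 3` are
numbered `0, 1, 2`. Unit eigenvector fields are unique up to sign, and exist locally; hence
`𝒪^A_{BC} = (γ^A_{BC})²` is a well-defined function, and its vanishing is required for all local
choices of the eigenvector fields. -/
structure IsNondegenerateQuiescentVacuumData
    (h : ∀ x : M, TangentSpace (𝓡 3) x →L[ℝ] TangentSpace (𝓡 3) x →L[ℝ] ℝ)
    (K : ∀ x : M, TangentSpace (𝓡 3) x →L[ℝ] TangentSpace (𝓡 3) x) : Prop where
  metric : IsSmoothRiemannianMetric h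
  smooth : IsSmoothEndoField K
  trace_eq_one : ∀ x, LinearMap.trace ℝ (TangentSpace (𝓡 3) x) (K x).toLinearMap = 1
  symmetric : ∀ x, ∀ ξ ζ : TangentSpace (𝓡 3) x, h x (K x ξ) ζ = h x ξ (K x ζ)
  trace_sq_eq_one :
    ∀ x, LinearMap.trace ℝ (TangentSpace (𝓡 3) x) ((K x).comp (K x)).toLinearMap = 1
  div_eq_zero : ∀ x j, divergence h K x j = 0
  distinct_eigenvalues :
    ∀ x, {μ : ℝ | Module.End.HasEigenvalue (K x).toLinearMap μ}.ncard = 3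
  /-- Local unit eigenframes exist (this follows from the preceding conditions). -/
  exists_eigenframe : ∀ x, ∃ (U : Set M) (p : Fin 3 → M → ℝ)
    (X : Fin 3 → ∀ x : M, TangentSpace (𝓡 3) x),
    IsOpen U ∧ x ∈ U ∧ IsUnitEigenframeOn h K U p X
  structure_sq_eq_zero : ∀ (U : Set M) (p : Fin 3 → M → ℝ)
    (X : Fin 3 → ∀ x : M, TangentSpace (𝓡 3) x) (γ : Fin 3 → Fin 3 → Fin 3 → M → ℝ),
    IsOpen U → IsUnitEigenframeOn h K U p X → IsStructureCoeffOn U X γ →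
    ∀ x ∈ U, (γ 0 1 2 x) ^ 2 = 0

end Data

/-! ### Fournodavlos and Luk initial data -/

/-- The functions `κ_i{}^l` determined by `c_{ij}` and `p_i`; the arguments are `i` (lower), then `l`
(upper), with the indices `1, 2, 3` numbered `0, 1, 2`. -/
def falKappa (c : Fin 3 → Fin 3 → T3 → ℝ) (p : Fin 3 → T3 → ℝ) (i l : Fin 3) (x : T3) : ℝ :=
  !![-p 0 x, (p 0 x - p 1 x) * (c 0 1 x / c 1 1 x),
      (p 1 x - p 0 x) * (c 0 1 x * c 1 2 x / (c 1 1 x * c 2 2 x))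
        + (p 0 x - p 2 x) * (c 0 2 x / c 2 2 x);
     0, -p 1 x, (p 1 x - p 2 x) * (c 1 2 x / c 2 2 x);
     0, 0, -p 2 x] i l

/-- Fournodavlos and Luk initial data on the singularity. -/
structure IsFournodavlosLukData (c : Fin 3 → Fin 3 → T3 → ℝ) (p : Fin 3 → T3 → ℝ) : Prop where
  smooth_c : ∀ i j, ContMDiff (𝓡 3) 𝓘(ℝ, ℝ) ∞ (c i j)
  smooth_p : ∀ i, ContMDiff (𝓡 3) 𝓘(ℝ, ℝ) ∞ (p i)
  symm : ∀ i j, c i j = c j i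
  ordered : ∀ x, p 0 x < p 1 x ∧ p 1 x < p 2 x
  pos : ∀ i x, 0 < c i i x
  sum_eq_one : ∀ x, ∑ i, p i x = 1
  sum_sq_eq_one : ∀ x, ∑ i, (p i x) ^ 2 = 1
  constraint : ∀ i x, ∑ l, (T3.partialDeriv i (c l l) x / c l l x * (p l x - p i x)
    + 2 * T3.partialDeriv l (falKappa c p i l) x
    + (if i < l then (1 : ℝ) else 0)
      * (T3.partialDeriv l (fun y => c 0 0 y * c 1 1 y * c 2 2 y) x
        / (c 0 0 x * c 1 1 x * c 2 2 x)) * falKappa c p i l x) = 0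

/-- The components `𝒦_i{}^j = -κ_i{}^j`. -/
def falKCoord (c : Fin 3 → Fin 3 → T3 → ℝ) (p : Fin 3 → T3 → ℝ) (i j : Fin 3) (x : T3) : ℝ :=
  -falKappa c p i j x

/-- The `(1,1)`-tensor field `𝒦 = ∑ 𝒦_i{}^j dxⁱ ⊗ ∂_j`. -/
def falK (c : Fin 3 → Fin 3 → T3 → ℝ) (p : Fin 3 → T3 → ℝ) (x : T3) :
    TangentSpace (𝓡 3) x →L[ℝ] TangentSpace (𝓡 3) x :=
  ∑ i, ∑ j, falKCoord c p i j x • (T3.dx i x).smulRight (T3.coordField j x)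

/-- The component `X̄_1^2` of the eigenframe `∂_1 + X̄_1^2 ∂_2 + X̄_1^3 ∂_3`, `∂_2 + X̄_2^3 ∂_3`, `∂_3`
of `𝒦`. -/
def falX12 (c : Fin 3 → Fin 3 → T3 → ℝ) (p : Fin 3 → T3 → ℝ) (x : T3) : ℝ :=
  1 / (p 0 x - p 1 x) * falKCoord c p 0 1 x

/-- The component `X̄_2^3` of the eigenframe. -/
def falX23 (c : Fin 3 → Fin 3 → T3 → ℝ) (p : Fin 3 → T3 → ℝ) (x : T3) : ℝ :=
  1 / (p 1 x - p 2 x) * falKCoord c p 1 2 x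

/-- The component `X̄_1^3` of the eigenframe. -/
def falX13 (c : Fin 3 → Fin 3 → T3 → ℝ) (p : Fin 3 → T3 → ℝ) (x : T3) : ℝ :=
  1 / (p 0 x - p 2 x) * (falKCoord c p 0 2 x
    + 1 / (p 0 x - p 1 x) * falKCoord c p 0 1 x * falKCoord c p 1 2 x)

/-- The co-frame `Ȳ^1 = dx¹`, `Ȳ^2 = dx² - X̄_1^2 dx¹`,
`Ȳ^3 = dx³ - X̄_2^3 dx² + (X̄_1^2 X̄_2^3 - X̄_1^3) dx¹` dual to the eigenframe. -/
def falY (c : Fin 3 → Fin 3 → T3 → ℝ) (p : Fin 3 → T3 → ℝ) (A : Fin 3) (x : T3) :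
    TangentSpace (𝓡 3) x →L[ℝ] ℝ :=
  ![T3.dx 0 x,
    T3.dx 1 x - falX12 c p x • T3.dx 0 x,
    T3.dx 2 x - falX23 c p x • T3.dx 1 x
      + (falX12 c p x * falX23 c p x - falX13 c p x) • T3.dx 0 x] A

/-- The metric `h̄ = ∑ A, c_{AA} Ȳ^A ⊗ Ȳ^A`. -/
def falMetric (c : Fin 3 → Fin 3 → T3 → ℝ) (p : Fin 3 → T3 → ℝ) (x : T3) :
    TangentSpace (𝓡 3) x →L[ℝ] TangentSpace (𝓡 3) x →L[ℝ] ℝ :=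
  ∑ A, c A A x • (falY c p A x).smulRight (falY c p A x)

end

/-! The charts of `𝕋³` invert the covering projection, so transition maps are translations, the
tangent bundle is globally `ℝ³`, and every condition becomes an identity between components in the
frame `∂ᵢ`.

The algebraic conditions rest on `falYFlat_falKFlat`: `𝒦` is triangular, and the coefficients `a, b,
d` are exactly those for which `Ȳ^A ∘ 𝒦 = p_A Ȳ^A`. As `h̄` is diagonal in this co-frame, `𝒦` is
symmetric with eigenvalues `p_A`, and the trace conditions are the two sum conditions on `p`. Any
eigenframe with increasing eigenvalues has its last two fields in the kernel of `Ȳ^1 = dx¹`. This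
form is closed, so it kills their bracket, and the structure coefficient vanishes
(`structureCoeff_eq_zero`).

For the divergence, symmetry of `𝒦` reduces the Christoffel terms to contractions of `∂h̄` with
`h̄⁻¹` and `h̄⁻¹𝒦` (`sum_christoffel_terms`), both diagonal in the dual frame `X̄_A`. The co-frame
is unipotent, so its derivatives drop out and `X̄_A^i X̄_A^l ∂_k h̄_{il} = ∂_k c_{AA}`. What remains
(`divergence_eq`) is `-1/2` times the Fournodavlos–Luk constraint. -/

noncomputable section

/-! ### Triviality of the tangent bundle of the torus -/

namespace T3

theorem extChartAt_symm_eq_proj (x₀ : T3) : ((extChartAt (𝓡 3) x₀).symm : E3 → T3) = proj := by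
  funext y
  exact proj_chart_symm (chart_mem_atlas E3 x₀) y

theorem proj_extChartAt {x₀ x : T3} (hx : x ∈ (chartAt E3 x₀).source) :
    proj (extChartAt (𝓡 3) x₀ x) = x := by
  rw [← extChartAt_symm_eq_proj x₀]
  exact (extChartAt (𝓡 3) x₀).left_inv (by rwa [extChartAt_source])

/-- The transition functions of the tangent bundle of `𝕋³` are trivial. -/
theorem tangentCoordChange_eq_id {x y z : T3} (hx : z ∈ (chartAt E3 x).source)
    (hy : z ∈ (chartAt E3 y).source) :
    tangentCoordChange (𝓡 3) x y z = ContinuousLinearMap.id ℝ E3 := by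
  have h1 := hasFDerivWithinAt_tangentCoordChange (I := 𝓡 3) (x := x) (y := y) (z := z)
    (by simpa only [extChartAt_source] using ⟨hx, hy⟩)
  rw [show range (𝓡 3) = univ from range_id, hasFDerivWithinAt_univ,
    extChartAt_symm_eq_proj] at h1
  set e := chartAt E3 y
  have hs : IsOpen (proj ⁻¹' e.source) := e.open_source.preimage isLocalHomeomorph_proj.continuous
  have hcont : ContinuousOn (fun y => e (proj y)) (proj ⁻¹' e.source) :=
    e.continuousOn.comp isLocalHomeomorph_proj.continuous.continuousOn fun _ h => h
  -- The transition map is `e ∘ proj`, which covers the identity of `𝕋³`; it is locally a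
  -- translation and has derivative the identity.
  have hev := eventually_translation hs hcont (fun w hw => by
    rw [← proj_chart_symm (chart_mem_atlas E3 y), e.left_inv hw])
    (u := extChartAt (𝓡 3) x z) (by rw [mem_preimage, proj_extChartAt hx]; exact hy)
  exact h1.unique (((hasFDerivAt_id _).add_const _).congr_of_eventuallyEq hev)

theorem continuousLinearMapAt_eq_id {x₀ x : T3} (hx : x ∈ (chartAt E3 x₀).source) :
    (trivializationAt E3 (TangentSpace (𝓡 3) : T3 → Type _) x₀).continuousLinearMapAt ℝ x
      = ContinuousLinearMap.id ℝ E3 := by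
  rw [TangentBundle.continuousLinearMapAt_trivializationAt_eq_core hx]
  exact tangentCoordChange_eq_id (mem_chart_source E3 x) hx

theorem symmL_eq_id {x₀ x : T3} (hx : x ∈ (chartAt E3 x₀).source) :
    (trivializationAt E3 (TangentSpace (𝓡 3) : T3 → Type _) x₀).symmL ℝ x
      = ContinuousLinearMap.id ℝ E3 := by
  rw [TangentBundle.symmL_trivializationAt_eq_core hx]
  exact tangentCoordChange_eq_id hx (mem_chart_source E3 x)

theorem mfderiv_extChartAt {x₀ x : T3} (hx : x ∈ (chartAt E3 x₀).source) :
    mfderiv (𝓡 3) 𝓘(ℝ, E3) (extChartAt (𝓡 3) x₀) x = ContinuousLinearMap.id ℝ E3 := by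
  rw [← TangentBundle.continuousLinearMapAt_trivializationAt hx]
  exact continuousLinearMapAt_eq_id hx

theorem mfderiv_extChartAt_symm (x₀ : T3) (y : E3) :
    mfderiv 𝓘(ℝ, E3) (𝓡 3) (extChartAt (𝓡 3) x₀).symm y = ContinuousLinearMap.id ℝ E3 := by
  rw [extChartAt_symm_eq_proj]
  exact (hasMFDerivAt_proj y).mfderiv

/-- A smooth `ℝ³`-valued function is a smooth vector field on `𝕋³`. -/
theorem contMDiff_vectorField {V : ∀ x : T3, TangentSpace (𝓡 3) x}
    (hV : ContMDiff (M' := E3) (𝓡 3) 𝓘(ℝ, E3) ∞ V) :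
    ContMDiff (𝓡 3) ((𝓡 3).prod 𝓘(ℝ, E3)) ∞
      (fun x => (⟨x, V x⟩ : TangentBundle (𝓡 3) T3)) := by
  intro x₀
  refine (contMDiffAt_section x₀).2 ?_
  refine (hV x₀).congr_of_eventuallyEq ?_
  filter_upwards [(chartAt E3 x₀).open_source.mem_nhds (mem_chart_source E3 x₀)] with x hx
  have h1 := congrArg (fun L : E3 →L[ℝ] E3 => L (V x)) (continuousLinearMapAt_eq_id hx)
  have h2 : (trivializationAt E3 (TangentSpace (𝓡 3) : T3 → Type _) x₀).continuousLinearMapAt ℝ x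
      (V x) = (trivializationAt E3 (TangentSpace (𝓡 3) : T3 → Type _) x₀ ⟨x, V x⟩).2 := by
    rw [Trivialization.continuousLinearMapAt_apply, Trivialization.linearMapAt_apply]
    exact if_pos hx
  exact h2.symm.trans h1

/-- In the bundle trivialization at any base point both coordinate changes are the identity, so the
local representative of `K` is `K` itself. -/
theorem contMDiff_endoField {K : ∀ x : T3, TangentSpace (𝓡 3) x →L[ℝ] TangentSpace (𝓡 3) x}
    (hK : ContMDiff (M' := E3 →L[ℝ] E3) (𝓡 3) 𝓘(ℝ, E3 →L[ℝ] E3) ∞ K) :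
    IsSmoothEndoField K := by
  intro x₀
  rw [contMDiffAt_hom_bundle]
  refine ⟨contMDiffAt_id, (hK x₀).congr_of_eventuallyEq ?_⟩
  filter_upwards [(chartAt E3 x₀).open_source.mem_nhds (mem_chart_source E3 x₀)] with x hx
  simp only [ContinuousLinearMap.inCoordinates]
  erw [continuousLinearMapAt_eq_id hx, symmL_eq_id hx]
  rfl

theorem contMDiff_bilinField {h : ∀ x : T3, TangentSpace (𝓡 3) x →L[ℝ] TangentSpace (𝓡 3) x →L[ℝ] ℝ}
    (hh : ContMDiff (M' := E3 →L[ℝ] E3 →L[ℝ] ℝ) (𝓡 3) 𝓘(ℝ, E3 →L[ℝ] E3 →L[ℝ] ℝ) ∞ h) :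
    ContMDiff (𝓡 3) ((𝓡 3).prod 𝓘(ℝ, E3 →L[ℝ] E3 →L[ℝ] ℝ)) ∞
      (fun x => TotalSpace.mk' (E3 →L[ℝ] E3 →L[ℝ] ℝ)
        (E := fun x : T3 => TangentSpace (𝓡 3) x →L[ℝ] TangentSpace (𝓡 3) x →L[ℝ] ℝ) x (h x)) := by
  intro x₀
  rw [contMDiffAt_hom_bundle]
  refine ⟨contMDiffAt_id, (hh x₀).congr_of_eventuallyEq ?_⟩
  filter_upwards [(chartAt E3 x₀).open_source.mem_nhds (mem_chart_source E3 x₀)] with x hx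
  ext v w
  have hb : x ∈ (trivializationAt E3 (TangentSpace (𝓡 3) : T3 → Type _) x₀).baseSet := hx
  erw [inCoordinates_apply_eq₂ hb hb (mem_univ _)]
  rw [← Trivialization.symmL_apply (R := ℝ) _ hb, ← Trivialization.symmL_apply (R := ℝ) _ hb]
  erw [symmL_eq_id hx, Bundle.Trivial.linearMapAt_trivialization]
  rfl

end T3

/-! ### The eigenframe and its dual co-frame in components -/

section Coordinates

variable (c : Fin 3 → Fin 3 → T3 → ℝ) (p : Fin 3 → T3 → ℝ)

/-- The components `Ȳ^A_i` of the co-frame. -/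
def falYCoord (A i : Fin 3) (x : T3) : ℝ :=
  !![1, 0, 0;
     -falX12 c p x, 1, 0;
     falX12 c p x * falX23 c p x - falX13 c p x, -falX23 c p x, 1] A i

/-- The components `X̄_A^i` of the eigenframe dual to `Ȳ^A`. -/
def falXCoord (A i : Fin 3) (x : T3) : ℝ :=
  !![1, falX12 c p x, falX13 c p x;
     0, 1, falX23 c p x;
     0, 0, 1] A i

/-- The eigenframe of `𝒦` dual to the co-frame `Ȳ^A`. -/
def falX (A : Fin 3) (x : T3) : E3 := WithLp.toLp 2 fun i => falXCoord c p A i x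

/-- The co-frame `Ȳ^A` as an `(ℝ³)*`-valued function. -/
def falYFlat (A : Fin 3) (x : T3) : E3 →L[ℝ] ℝ := falY c p A x

/-- The tensor field `𝒦` as a function with values in the endomorphisms of `ℝ³`. -/
def falKFlat (x : T3) : E3 →L[ℝ] E3 := falK c p x

/-- The metric `h̄` as a function with values in the bilinear forms on `ℝ³`. -/
def falMetricFlat (x : T3) : E3 →L[ℝ] E3 →L[ℝ] ℝ := falMetric c p x

theorem falYFlat_apply (A : Fin 3) (x : T3) (v : E3) :
    falYFlat c p A x v = ∑ i, falYCoord c p A i x * v i := by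
  have h : ∀ i, (T3.dx i x : E3 →L[ℝ] ℝ) v = v i := fun i => rfl
  fin_cases A
  · change (T3.dx 0 x : E3 →L[ℝ] ℝ) v = _
    simp [falYCoord, Fin.sum_univ_three, h]
  · change (T3.dx 1 x : E3 →L[ℝ] ℝ) v - falX12 c p x * (T3.dx 0 x : E3 →L[ℝ] ℝ) v = _
    simp [falYCoord, Fin.sum_univ_three, h]
    ring
  · change (T3.dx 2 x : E3 →L[ℝ] ℝ) v - falX23 c p x * (T3.dx 1 x : E3 →L[ℝ] ℝ) v
      + (falX12 c p x * falX23 c p x - falX13 c p x) * (T3.dx 0 x : E3 →L[ℝ] ℝ) v = _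
    simp [falYCoord, Fin.sum_univ_three, h]
    ring

theorem falKFlat_apply (x : T3) (v : E3) (j : Fin 3) :
    (falKFlat c p x v) j = ∑ i, falKCoord c p i j x * v i := by
  have h : falKFlat c p x = ∑ i, ∑ j, falKCoord c p i j x •
    (EuclideanSpace.proj i : E3 →L[ℝ] ℝ).smulRight (EuclideanSpace.single j (1 : ℝ)) := rfl
  rw [h]
  simp [sum_apply, Pi.single_apply]

theorem falMetricFlat_apply (x : T3) (v w : E3) :
    falMetricFlat c p x v w
      = ∑ A, c A A x * (falYFlat c p A x v * falYFlat c p A x w) := by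
  have h : falMetricFlat c p x
    = ∑ A, c A A x • (falYFlat c p A x).smulRight (falYFlat c p A x) := rfl
  rw [h]
  simp [sum_apply]

theorem falKCoord_of_lt {i j : Fin 3} (h : j < i) : falKCoord c p i j = fun _ => 0 := by
  funext x
  fin_cases i <;> fin_cases j <;> simp_all [falKCoord, falKappa]

theorem falKCoord_self (i : Fin 3) : falKCoord c p i i = p i := by
  funext x
  fin_cases i <;> simp [falKCoord, falKappa]

end Coordinates

namespace IsFournodavlosLukData

variable {c : Fin 3 → Fin 3 → T3 → ℝ} {p : Fin 3 → T3 → ℝ} (hd : IsFournodavlosLukData c p)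
include hd

/-- Inverting the definitions of `X̄` makes the entries of `𝒦` polynomial in `X̄` and `p`; the
eigen-form equations then become polynomial identities without denominators. -/
theorem falKCoord_zero_one (x : T3) : falKCoord c p 0 1 x = falX12 c p x * (p 0 x - p 1 x) := by
  have := sub_ne_zero.2 (hd.ordered x).1.ne
  rw [falX12]
  field_simp

theorem falKCoord_one_two (x : T3) : falKCoord c p 1 2 x = falX23 c p x * (p 1 x - p 2 x) := by
  have := sub_ne_zero.2 (hd.ordered x).2.ne
  rw [falX23]
  field_simp

theorem falKCoord_zero_two (x : T3) : falKCoord c p 0 2 x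
    = falX13 c p x * (p 0 x - p 2 x) - falX12 c p x * falX23 c p x * (p 1 x - p 2 x) := by
  have h := sub_ne_zero.2 ((hd.ordered x).1.trans (hd.ordered x).2).ne
  have e : falX13 c p x * (p 0 x - p 2 x)
      = falKCoord c p 0 2 x + falX12 c p x * falKCoord c p 1 2 x := by
    rw [falX13, ← falX12]
    field_simp
  rw [e, hd.falKCoord_one_two]
  ring

/-- The co-frame `Ȳ^A` consists of eigen-forms of `𝒦`. -/
theorem falYFlat_falKFlat (A : Fin 3) (x : T3) (v : E3) :
    falYFlat c p A x (falKFlat c p x v)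
      = p A x * falYFlat c p A x v := by
  simp only [falYFlat_apply, falKFlat_apply, Fin.sum_univ_three, falKCoord_self, hd.falKCoord_zero_one,
    hd.falKCoord_one_two, hd.falKCoord_zero_two,
    falKCoord_of_lt c p (show (0 : Fin 3) < 1 by decide),
    falKCoord_of_lt c p (show (0 : Fin 3) < 2 by decide),
    falKCoord_of_lt c p (show (1 : Fin 3) < 2 by decide)]
  fin_cases A <;> simp [falYCoord] <;> ring

end IsFournodavlosLukData

section Coframe

variable (c : Fin 3 → Fin 3 → T3 → ℝ) (p : Fin 3 → T3 → ℝ)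

theorem falYFlat_falX (A B : Fin 3) (x : T3) :
    falYFlat c p A x (falX c p B x) = if A = B then 1 else 0 := by
  rw [falYFlat_apply]
  fin_cases A <;> fin_cases B <;> simp [falYCoord, falX, falXCoord, Fin.sum_univ_three]
  ring

/-- The co-frame matrix is unipotent lower triangular, so forward substitution recovers a vector
from its pairings. -/
theorem eq_of_falY_eq {x : T3} {v w : E3}
    (h : ∀ A, falYFlat c p A x v = falYFlat c p A x w) : v = w := by
  simp only [falYFlat_apply, Fin.sum_univ_three] at h
  have h0 := h 0
  have h1 := h 1
  have h2 := h 2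
  simp [falYCoord] at h0 h1 h2
  rw [h0] at h1 h2
  have h1' := add_left_cancel h1
  rw [h1'] at h2
  have h2' := add_left_cancel h2
  ext i
  fin_cases i
  · exact h0
  · exact h1'
  · exact h2'

end Coframe

namespace IsFournodavlosLukData

variable {c : Fin 3 → Fin 3 → T3 → ℝ} {p : Fin 3 → T3 → ℝ} (hd : IsFournodavlosLukData c p)
include hd

/-- Both sides have the same pairings with the co-frame, by duality and the eigen-form property. -/
theorem falKFlat_falX (A : Fin 3) (x : T3) :
    falKFlat c p x (falX c p A x) = p A x • falX c p A x := by
  refine eq_of_falY_eq c p (x := x) fun B => ?_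
  rw [hd.falYFlat_falKFlat, map_smul, falYFlat_falX, smul_eq_mul]
  split_ifs with h
  · rw [h]
  · simp

theorem falMetricFlat_pos (x : T3) {v : E3} (hv : v ≠ 0) :
    0 < falMetricFlat c p x v v := by
  rw [falMetricFlat_apply]
  have hne : ∃ A, falYFlat c p A x v ≠ 0 := by
    by_contra! h
    exact hv (eq_of_falY_eq c p (x := x) fun A => by rw [h A, map_zero])
  obtain ⟨A, hA⟩ := hne
  refine Finset.sum_pos' (fun B _ => mul_nonneg (hd.pos B x).le (mul_self_nonneg _))
    ⟨A, Finset.mem_univ _, mul_pos (hd.pos A x) (mul_self_pos.2 hA)⟩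

theorem contMDiff_falKappa (i j : Fin 3) :
    ContMDiff (𝓡 3) 𝓘(ℝ, ℝ) ∞ (falKappa c p i j) := by
  have hp := hd.smooth_p
  have hdiv : ∀ {f g : T3 → ℝ}, ContMDiff (𝓡 3) 𝓘(ℝ, ℝ) ∞ f → ContMDiff (𝓡 3) 𝓘(ℝ, ℝ) ∞ g →
      (∀ x, g x ≠ 0) → ContMDiff (𝓡 3) 𝓘(ℝ, ℝ) ∞ (fun x => f x / g x) := fun hf hg h0 =>
    hf.div₀ hg h0
  have hc := hd.smooth_c
  have h1 : ∀ i x, c i i x ≠ 0 := fun i x => (hd.pos i x).ne'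
  fin_cases i <;> fin_cases j
  · exact (hp 0).neg
  · exact ((hp 0).sub (hp 1)).mul (hdiv (hc 0 1) (hc 1 1) (h1 1))
  · exact (((hp 1).sub (hp 0)).mul (hdiv ((hc 0 1).mul (hc 1 2)) ((hc 1 1).mul (hc 2 2))
      fun x => mul_ne_zero (h1 1 x) (h1 2 x))).add
      (((hp 0).sub (hp 2)).mul (hdiv (hc 0 2) (hc 2 2) (h1 2)))
  · exact contMDiff_const
  · exact (hp 1).neg
  · exact ((hp 1).sub (hp 2)).mul (hdiv (hc 1 2) (hc 2 2) (h1 2))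
  · exact contMDiff_const
  · exact contMDiff_const
  · exact (hp 2).neg

theorem contMDiff_falKCoord (i j : Fin 3) :
    ContMDiff (𝓡 3) 𝓘(ℝ, ℝ) ∞ (falKCoord c p i j) :=
  (hd.contMDiff_falKappa i j).neg

theorem contMDiff_falX12 : ContMDiff (𝓡 3) 𝓘(ℝ, ℝ) ∞ (falX12 c p) :=
  ((contMDiff_const (c := (1 : ℝ))).div₀ ((hd.smooth_p 0).sub (hd.smooth_p 1))
    fun x => sub_ne_zero.2 (hd.ordered x).1.ne).mul (hd.contMDiff_falKCoord 0 1)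

theorem contMDiff_falX23 : ContMDiff (𝓡 3) 𝓘(ℝ, ℝ) ∞ (falX23 c p) :=
  ((contMDiff_const (c := (1 : ℝ))).div₀ ((hd.smooth_p 1).sub (hd.smooth_p 2))
    fun x => sub_ne_zero.2 (hd.ordered x).2.ne).mul (hd.contMDiff_falKCoord 1 2)

theorem contMDiff_falX13 : ContMDiff (𝓡 3) 𝓘(ℝ, ℝ) ∞ (falX13 c p) :=
  ((contMDiff_const (c := (1 : ℝ))).div₀ ((hd.smooth_p 0).sub (hd.smooth_p 2))
    fun x => sub_ne_zero.2 ((hd.ordered x).1.trans (hd.ordered x).2).ne).mul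
    ((hd.contMDiff_falKCoord 0 2).add (hd.contMDiff_falX12.mul (hd.contMDiff_falKCoord 1 2)))

theorem contMDiff_falYCoord (A i : Fin 3) :
    ContMDiff (𝓡 3) 𝓘(ℝ, ℝ) ∞ (falYCoord c p A i) := by
  have ha := hd.contMDiff_falX12
  have hb := hd.contMDiff_falX23
  have he := hd.contMDiff_falX13
  fin_cases A <;> fin_cases i
  · exact contMDiff_const
  · exact contMDiff_const
  · exact contMDiff_const
  · exact ha.neg
  · exact contMDiff_const
  · exact contMDiff_const
  · exact (ha.mul hb).sub he
  · exact hb.neg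
  · exact contMDiff_const

theorem contMDiff_falXCoord (A i : Fin 3) :
    ContMDiff (𝓡 3) 𝓘(ℝ, ℝ) ∞ (falXCoord c p A i) := by
  fin_cases A <;> fin_cases i
  · exact contMDiff_const
  · exact hd.contMDiff_falX12
  · exact hd.contMDiff_falX13
  · exact contMDiff_const
  · exact contMDiff_const
  · exact hd.contMDiff_falX23
  · exact contMDiff_const
  · exact contMDiff_const
  · exact contMDiff_const

end IsFournodavlosLukData

/-! ### Smoothness of the tensor fields, traces and spectrum -/

theorem contMDiff_sum_smul_const {F : Type*} [NormedAddCommGroup F] [NormedSpace ℝ F]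
    {ι : Type*} [Fintype ι] {f : ι → T3 → ℝ} (hf : ∀ i, ContMDiff (𝓡 3) 𝓘(ℝ, ℝ) ∞ (f i))
    (v : ι → F) : ContMDiff (𝓡 3) 𝓘(ℝ, F) ∞ (fun x => ∑ i, f i x • v i) := by
  refine contMDiff_finsetSum fun i _ => ?_
  exact (hf i).smul contMDiff_const

/-- The unit balls of a positive definite form on `ℝ³` are bounded. -/
theorem isVonNBounded_of_pos (B : E3 →L[ℝ] E3 →L[ℝ] ℝ) (hB : ∀ v, v ≠ 0 → 0 < B v v) :
    Bornology.IsVonNBounded ℝ {v : E3 | B v v < 1} := by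
  have hcont : Continuous fun v : E3 => B v v := by fun_prop
  -- The minimum `m > 0` of the form on the unit sphere gives `m ‖v‖² ≤ B v v` by homogeneity, hence
  -- the radius `√(1 / m)`.
  obtain ⟨w, hw, hmin⟩ := (isCompact_sphere (0 : E3) 1).exists_isMinOn
    ((NormedSpace.sphere_nonempty).2 zero_le_one) hcont.continuousOn
  have hw0 : w ≠ 0 := by
    rintro rfl
    simp at hw
  set m := B w w
  have hm : 0 < m := hB w hw0
  rw [NormedSpace.isVonNBounded_iff]
  refine (Metric.isBounded_closedBall (x := (0 : E3)) (r := √(1 / m))).subset fun v hv => ?_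
  rw [mem_closedBall_zero_iff]
  refine Real.le_sqrt_of_sq_le ?_
  rw [le_div_iff₀ hm]
  rcases eq_or_ne v 0 with rfl | hv0
  · simp
  have hn : ‖v‖ ≠ 0 := norm_ne_zero_iff.2 hv0
  have h1 : m ≤ B (‖v‖⁻¹ • v) (‖v‖⁻¹ • v) := hmin (by
    rw [mem_sphere_zero_iff_norm, norm_smul, norm_inv, norm_norm, inv_mul_cancel₀ hn])
  simp only [map_smul, smul_apply, smul_eq_mul] at h1
  have h2 : ‖v‖ ^ 2 * m ≤ ‖v‖ ^ 2 * (‖v‖⁻¹ * (‖v‖⁻¹ * B v v)) :=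
    mul_le_mul_of_nonneg_left h1 (sq_nonneg _)
  have h3 : ‖v‖ ^ 2 * (‖v‖⁻¹ * (‖v‖⁻¹ * B v v)) = B v v := by field_simp
  exact (h2.trans_eq h3).trans (le_of_lt hv)

theorem trace_eq_sum_apply_single (T : E3 →ₗ[ℝ] E3) :
    LinearMap.trace ℝ E3 T = ∑ i, T (EuclideanSpace.single i 1) i := by
  rw [LinearMap.trace_eq_matrix_trace ℝ (EuclideanSpace.basisFun (Fin 3) ℝ).toBasis, Matrix.trace]
  simp [LinearMap.toMatrix_apply]

namespace IsFournodavlosLukData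

variable {c : Fin 3 → Fin 3 → T3 → ℝ} {p : Fin 3 → T3 → ℝ} (hd : IsFournodavlosLukData c p)
include hd

theorem contMDiff_falX (A : Fin 3) : ContMDiff (𝓡 3) 𝓘(ℝ, E3) ∞ (falX c p A) := by
  convert! contMDiff_sum_smul_const (hd.contMDiff_falXCoord A)
    (fun i => EuclideanSpace.single i (1 : ℝ)) using 1
  funext x
  ext j
  simp [falX, Pi.single_apply]

theorem contMDiff_falKFlat : ContMDiff (𝓡 3) 𝓘(ℝ, E3 →L[ℝ] E3) ∞ (falKFlat c p) := by
  convert! contMDiff_sum_smul_const (fun ij : Fin 3 × Fin 3 => hd.contMDiff_falKCoord ij.1 ij.2)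
    (fun ij => (EuclideanSpace.proj ij.1 : E3 →L[ℝ] ℝ).smulRight
      (EuclideanSpace.single ij.2 (1 : ℝ))) using 1
  funext x
  ext v j
  simp [falKFlat_apply, sum_apply, Fintype.sum_prod_type, Pi.single_apply]

theorem contMDiff_falMetricFlat :
    ContMDiff (𝓡 3) 𝓘(ℝ, E3 →L[ℝ] E3 →L[ℝ] ℝ) ∞ (falMetricFlat c p) := by
  convert! contMDiff_sum_smul_const
    (fun a : Fin 3 × Fin 3 × Fin 3 => (hd.smooth_c a.1 a.1).mul
      ((hd.contMDiff_falYCoord a.1 a.2.1).mul (hd.contMDiff_falYCoord a.1 a.2.2)))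
    (fun a => (EuclideanSpace.proj a.2.1 : E3 →L[ℝ] ℝ).smulRight
      (EuclideanSpace.proj a.2.2 : E3 →L[ℝ] ℝ)) using 1
  funext x
  ext v w
  simp [falMetricFlat_apply, falYFlat_apply, Fintype.sum_prod_type, Fin.sum_univ_three]
  ring

theorem isSmoothEndoField_falK : IsSmoothEndoField (falK c p) :=
  T3.contMDiff_endoField hd.contMDiff_falKFlat

theorem isSmoothRiemannianMetric_falMetric : IsSmoothRiemannianMetric (falMetric c p) :=
  ⟨{ inner := falMetric c p
     symm := fun x v w => by
      refine (falMetricFlat_apply c p x v w).trans (.trans ?_ (falMetricFlat_apply c p x w v).symm)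
      exact Finset.sum_congr rfl fun A _ => congrArg (c A A x * ·) (mul_comm _ _)
     pos := fun x v hv => hd.falMetricFlat_pos x hv
     isVonNBounded := fun x => isVonNBounded_of_pos (falMetricFlat c p x)
      fun v hv => hd.falMetricFlat_pos x hv
     contMDiff := T3.contMDiff_bilinField hd.contMDiff_falMetricFlat }, fun _ => rfl⟩

theorem falMetricFlat_falKFlat (x : T3) (v w : E3) :
    falMetricFlat c p x (falKFlat c p x v) w = falMetricFlat c p x v (falKFlat c p x w) := by
  simp only [falMetricFlat_apply, hd.falYFlat_falKFlat]
  exact Finset.sum_congr rfl fun A _ => by ring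

theorem trace_falKFlat (x : T3) : LinearMap.trace ℝ E3 (falKFlat c p x).toLinearMap = 1 := by
  rw [trace_eq_sum_apply_single]
  refine Eq.trans ?_ (hd.sum_eq_one x)
  simp [falKFlat_apply, falKCoord_self]

/-- The matrix of `𝒦` is triangular, so its square has diagonal entries `p_i²`. -/
theorem trace_falKFlat_sq (x : T3) :
    LinearMap.trace ℝ E3 ((falKFlat c p x).comp (falKFlat c p x)).toLinearMap = 1 := by
  rw [trace_eq_sum_apply_single]
  refine Eq.trans ?_ (hd.sum_sq_eq_one x)
  simp [falKFlat_apply, Fin.sum_univ_three, falKCoord_self,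
    falKCoord_of_lt c p (show (0 : Fin 3) < 1 by decide),
    falKCoord_of_lt c p (show (0 : Fin 3) < 2 by decide),
    falKCoord_of_lt c p (show (1 : Fin 3) < 2 by decide), sq]

theorem strictMono (x : T3) : StrictMono fun A => p A x := by
  rw [Fin.strictMono_iff_lt_succ]
  intro i
  fin_cases i
  · exact (hd.ordered x).1
  · exact (hd.ordered x).2

omit hd in
theorem falX_ne_zero (A : Fin 3) (x : T3) : falX c p A x ≠ 0 := by
  intro h
  have := falYFlat_falX c p A A x
  rw [h, map_zero, if_pos rfl] at this
  exact zero_ne_one this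

/-- Some `Ȳ^A` does not vanish on `v`, and evaluating it on the eigenvalue equation gives `p_A
Ȳ^A(v) = μ Ȳ^A(v)`. -/
theorem exists_eq_of_eigenvector {x : T3} {v : E3} (hv : v ≠ 0) {μ : ℝ}
    (h : falKFlat c p x v = μ • v) : ∃ A, p A x = μ ∧ falYFlat c p A x v ≠ 0 := by
  have hne : ∃ A, falYFlat c p A x v ≠ 0 := by
    by_contra! h
    exact hv (eq_of_falY_eq c p (x := x) fun A => by rw [h A, map_zero])
  obtain ⟨A, hA⟩ := hne
  refine ⟨A, ?_, hA⟩
  have := hd.falYFlat_falKFlat A x v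
  rw [h, map_smul, smul_eq_mul] at this
  exact (mul_right_cancel₀ hA this).symm

theorem ncard_eigenvalues (x : T3) :
    {μ : ℝ | Module.End.HasEigenvalue (falKFlat c p x).toLinearMap μ}.ncard = 3 := by
  have h : {μ : ℝ | Module.End.HasEigenvalue (falKFlat c p x).toLinearMap μ}
      = range fun A => p A x := by
    ext μ
    constructor
    · intro hμ
      obtain ⟨v, hv⟩ := hμ.exists_hasEigenvector
      obtain ⟨A, hA, -⟩ := hd.exists_eq_of_eigenvector hv.2 hv.apply_eq_smul
      exact ⟨A, hA⟩
    · rintro ⟨A, rfl⟩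
      exact Module.End.hasEigenvalue_of_hasEigenvector (x := falX c p A x)
        ⟨Module.End.mem_eigenspace_iff.2 (hd.falKFlat_falX A x), falX_ne_zero A x⟩
  rw [h, ← Set.image_univ, Set.ncard_image_of_injective _ (hd.strictMono x).injective,
    Set.ncard_univ, Nat.card_eq_fintype_card, Fintype.card_fin]

/-- The eigenvalues in any ordered eigenframe are the `p_A`. -/
theorem eigenvalue_eq {x : T3} {q : Fin 3 → ℝ} (hq : StrictMono q) {X : Fin 3 → E3}
    (hX : ∀ A, X A ≠ 0) (h : ∀ A, falKFlat c p x (X A) = q A • X A) (A : Fin 3) : q A = p A x := by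
  have hr : range q = range fun A => p A x := by
    -- One inclusion suffices because both ranges have three elements; a strictly increasing family
    -- is then determined by its range.
    refine Set.eq_of_subset_of_ncard_le ?_ ?_ (Set.finite_range _)
    · rintro _ ⟨A, rfl⟩
      obtain ⟨B, hB, -⟩ := hd.exists_eq_of_eigenvector (hX A) (h A)
      exact ⟨B, hB⟩
    · rw [← Set.image_univ, ← Set.image_univ, Set.ncard_image_of_injective _ hq.injective,
        Set.ncard_image_of_injective _ (hd.strictMono x).injective]
  exact congrFun ((hq.range_inj (hd.strictMono x)).1 hr) A

/-- Eigen-forms and eigenvectors for distinct eigenvalues annihilate each other; on the diagonal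
some pairing is nonzero, and only the matching index is left. This controls an arbitrary eigenframe,
not just `X̄_A`. -/
theorem falYFlat_eigenframe {x : T3} {q : Fin 3 → ℝ} (hq : StrictMono q) {X : Fin 3 → E3}
    (hX : ∀ A, X A ≠ 0) (h : ∀ A, falKFlat c p x (X A) = q A • X A) (A B : Fin 3) :
    falYFlat c p A x (X B) = 0 ↔ A ≠ B := by
  have key : A ≠ B → falYFlat c p A x (X B) = 0 := by
    intro hAB
    by_contra h0
    have h1 := hd.falYFlat_falKFlat A x (X B)
    rw [h, map_smul, smul_eq_mul] at h1
    have h2 := mul_right_cancel₀ h0 h1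
    rw [hd.eigenvalue_eq hq hX h] at h2
    exact hAB ((hd.strictMono x).injective h2.symm)
  refine ⟨?_, key⟩
  rintro h0 rfl
  obtain ⟨B, hB, hne⟩ := hd.exists_eq_of_eigenvector (hX A) (h A)
  rw [hd.eigenvalue_eq hq hX h] at hB
  exact hne ((hd.strictMono x).injective hB ▸ h0)

/-- The eigenframe `X̄_A`, normalized. -/
theorem isUnitEigenframeOn : IsUnitEigenframeOn (falMetric c p) (falK c p) univ p
    (fun A x => ((√(c A A x))⁻¹ • falX c p A x : E3)) where
  smooth A := by
    -- The factor normalizes `X̄_A` because `h̄(X̄_A, X̄_A) = c_{AA}`; it is smooth because `c_{AA}`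
    -- is positive.
    have hs : ContMDiff (𝓡 3) 𝓘(ℝ, ℝ) ∞ fun x => (√(c A A x))⁻¹ := by
      intro x
      have h1 : ContDiffAt ℝ ∞ (fun t : ℝ => (√t)⁻¹) (c A A x) :=
        (contDiffAt_id.sqrt (hd.pos A x).ne').inv (Real.sqrt_pos.2 (hd.pos A x)).ne'
      exact h1.contMDiffAt.comp x (hd.smooth_c A A x)
    exact (T3.contMDiff_vectorField (hs.smul (hd.contMDiff_falX A))).contMDiffOn
  eigen x _ A := by
    change falKFlat c p x ((√(c A A x))⁻¹ • falX c p A x) = p A x • (√(c A A x))⁻¹ • falX c p A x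
    rw [map_smul, hd.falKFlat_falX, smul_comm]
  unit x _ A := by
    change falMetricFlat c p x ((√(c A A x))⁻¹ • falX c p A x)
      ((√(c A A x))⁻¹ • falX c p A x) = 1
    have h1 := Real.sq_sqrt (hd.pos A x).le
    have h2 := (Real.sqrt_pos.2 (hd.pos A x)).ne'
    simp only [map_smul, smul_apply, smul_eq_mul, falMetricFlat_apply, falYFlat_falX]
    simp
    field_simp
    rw [h1]
  ordered x _ := hd.strictMono x

end IsFournodavlosLukData

/-! ### Closedness of `dx¹` and vanishing of the structure coefficient -/

namespace T3

theorem mpullbackWithin_extChartAt_symm (x₀ : T3) (V : ∀ x : T3, TangentSpace (𝓡 3) x) (y : E3) :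
    (VectorField.mpullbackWithin 𝓘(ℝ, E3) (𝓡 3) (extChartAt (𝓡 3) x₀).symm V (range (𝓡 3)) y : E3)
      = V (proj y) := by
  rw [VectorField.mpullbackWithin_apply, show range (𝓡 3) = univ from range_id, mfderivWithin_univ]
  erw [mfderiv_extChartAt_symm]
  rw [extChartAt_symm_eq_proj]
  exact congrArg (fun L : E3 →L[ℝ] E3 => L (V (proj y))) ContinuousLinearMap.inverse_id

theorem fderiv_apply_eq_zero {F : E3 → E3} {i : Fin 3} {y : E3} (hF : ∀ᶠ z in 𝓝 y, F z i = 0)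
    (v : E3) : fderiv ℝ F y v i = 0 := by
  by_cases hd : DifferentiableAt ℝ F y
  · have h1 : HasFDerivAt (fun z => F z i)
        ((EuclideanSpace.proj i : E3 →L[ℝ] ℝ).comp (fderiv ℝ F y)) y :=
      (EuclideanSpace.proj i : E3 →L[ℝ] ℝ).hasFDerivAt.comp y hd.hasFDerivAt
    have h2 : HasFDerivAt (fun z => F z i) (0 : E3 →L[ℝ] ℝ) y :=
      (hasFDerivAt_const (0 : ℝ) y).congr_of_eventuallyEq hF
    exact congrArg (fun L : E3 →L[ℝ] ℝ => L v) (h1.unique h2)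
  -- Without differentiability the derivative is zero by convention, so no regularity of the fields
  -- is needed.
  · rw [fderiv_zero_of_not_differentiableAt hd]
    rfl

/-- The one-form `dxⁱ` is closed: if it annihilates two vector fields near `x`, then it annihilates
their bracket at `x`. -/
theorem dx_mlieBracket_eq_zero {V W : ∀ x : T3, TangentSpace (𝓡 3) x} {i : Fin 3} {x : T3}
    (hV : ∀ᶠ z in 𝓝 x, dx i z (V z) = 0) (hW : ∀ᶠ z in 𝓝 x, dx i z (W z) = 0) :
    dx i x (VectorField.mlieBracket (𝓡 3) V W x) = 0 := by
  have hx : proj (extChartAt (𝓡 3) x x) = x := proj_extChartAt (mem_chart_source E3 x)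
  have hc : Tendsto proj (𝓝 (extChartAt (𝓡 3) x x)) (𝓝 x) := by
    have := isLocalHomeomorph_proj.continuous.tendsto (extChartAt (𝓡 3) x x)
    rwa [hx] at this
  have hb : (VectorField.mlieBracket (𝓡 3) V W x : E3)
      = VectorField.lieBracket ℝ (fun y => (V (proj y) : E3)) (fun y => (W (proj y) : E3))
        (extChartAt (𝓡 3) x x) := by
    refine (congrArg (fun L : E3 →L[ℝ] E3 => L.inverse _)
      (mfderiv_extChartAt (mem_chart_source E3 x))).trans ?_
    refine (congrArg (fun L : E3 →L[ℝ] E3 => L _) ContinuousLinearMap.inverse_id).trans ?_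
    refine (ContinuousLinearMap.id_apply ..).trans ?_
    have h := fun V => funext (mpullbackWithin_extChartAt_symm x V)
    refine (congrArg₂ (fun V W : E3 → E3 => VectorField.lieBracketWithin ℝ V W _ _)
      (h V) (h W)).trans ?_
    rw [preimage_univ, univ_inter, show range (𝓡 3) = univ from range_id]
    exact congrFun VectorField.lieBracketWithin_univ _
  refine (congrArg (fun v : E3 => v i) hb).trans ?_
  -- In the flat chart `[V, W] = DW(V) - DV(W)`, and the `i`-th component of each term vanishes
  -- separately.
  have h1 := fderiv_apply_eq_zero (F := fun y => (W (proj y) : E3)) (hc.eventually hW)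
    (V (proj (extChartAt (𝓡 3) x x)))
  have h2 := fderiv_apply_eq_zero (F := fun y => (V (proj y) : E3)) (hc.eventually hV)
    (W (proj (extChartAt (𝓡 3) x x)))
  exact (congrArg₂ (· - ·) h1 h2).trans (sub_zero 0)

end T3

theorem IsFournodavlosLukData.structureCoeff_eq_zero {c : Fin 3 → Fin 3 → T3 → ℝ}
    {p : Fin 3 → T3 → ℝ} (hd : IsFournodavlosLukData c p) {U : Set T3} {q : Fin 3 → T3 → ℝ}
    {X : Fin 3 → ∀ x : T3, TangentSpace (𝓡 3) x} {γ : Fin 3 → Fin 3 → Fin 3 → T3 → ℝ}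
    (hU : IsOpen U) (hX : IsUnitEigenframeOn (falMetric c p) (falK c p) U q X)
    (hγ : IsStructureCoeffOn U X γ) {x : T3} (hx : x ∈ U) : γ 0 1 2 x = 0 := by
  have hY : ∀ z ∈ U, ∀ A B, falYFlat c p A z (X B z) = 0 ↔ A ≠ B := by
    intro z hz A B
    refine hd.falYFlat_eigenframe (X := fun A => X A z) (hX.ordered z hz) (fun A h0 => ?_)
      (fun A => hX.eigen z hz A) A B
    have h1 : falMetricFlat c p z (X A z) (X A z) = 1 := hX.unit z hz A
    have h2 : falMetricFlat c p z (0 : E3) (0 : E3) = 1 :=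
      (congrArg (fun v : E3 => falMetricFlat c p z v v) h0).symm.trans h1
    simp at h2
  -- Here `Ȳ^1 = dx¹` by definition, so the closed form `dx¹` detects exactly the first eigenvector.
  have hdx : ∀ z ∈ U, ∀ B, T3.dx 0 z (X B z) = 0 ↔ (0 : Fin 3) ≠ B := fun z hz B => hY z hz 0 B
  have h0 : T3.dx 0 x (VectorField.mlieBracket (𝓡 3) (X 1) (X 2) x) = 0 := by
    refine T3.dx_mlieBracket_eq_zero ?_ ?_
    · filter_upwards [hU.mem_nhds hx] with z hz using (hdx z hz 1).2 (by decide)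
    · filter_upwards [hU.mem_nhds hx] with z hz using (hdx z hz 2).2 (by decide)
  rw [hγ x hx 1 2, Fin.sum_univ_three, map_add, map_add, map_smul, map_smul, map_smul,
    (hdx x hx 1).2 (by decide), (hdx x hx 2).2 (by decide), smul_zero, smul_zero, add_zero,
    add_zero, smul_eq_mul] at h0
  exact (mul_eq_zero.1 h0).resolve_right fun h => (hdx x hx 0).1 h rfl

/-! ### Partial derivatives and tensor components on the universal cover -/

theorem pderivE3_mul {f g : E3 → ℝ} {y : E3} (i : Fin 3) (hf : DifferentiableAt ℝ f y)
    (hg : DifferentiableAt ℝ g y) :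
    pderivE3 i (fun z => f z * g z) y = pderivE3 i f y * g y + f y * pderivE3 i g y := by
  simp only [pderivE3, fderiv_fun_mul hf hg, add_apply, smul_apply, smul_eq_mul]
  ring

theorem pderivE3_neg {f : E3 → ℝ} {y : E3} (i : Fin 3) :
    pderivE3 i (fun z => -f z) y = -pderivE3 i f y := by
  simp only [pderivE3, fderiv_fun_neg, neg_apply]

theorem pderivE3_const (i : Fin 3) (a : ℝ) (y : E3) : pderivE3 i (fun _ => a) y = 0 := by
  simp [pderivE3]

theorem pderivE3_fun_sum {f : Fin 3 → E3 → ℝ} {y : E3} (i : Fin 3)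
    (hf : ∀ A, DifferentiableAt ℝ (f A) y) :
    pderivE3 i (fun z => ∑ A, f A z) y = ∑ A, pderivE3 i (f A) y := by
  simp only [pderivE3, fderiv_fun_sum fun A _ => hf A, sum_apply]

namespace T3

/-- Chain rule with `d proj = id`: derivatives on the torus are those of the periodic lift. -/
theorem hasFDerivAt_comp_proj {f : T3 → ℝ} (hf : ContMDiff (𝓡 3) 𝓘(ℝ, ℝ) ∞ f) (y : E3)
    {L : E3 →L[ℝ] ℝ} (hL : mfderiv (𝓡 3) 𝓘(ℝ, ℝ) f (proj y) = L) :
    HasFDerivAt (fun z => f (proj z)) L y := by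
  subst hL
  have h1 := ((hf.mdifferentiable (by simp)) (proj y)).hasMFDerivAt
  have h2 := h1.comp y (hasMFDerivAt_proj y)
  exact h2.hasFDerivAt

theorem differentiableAt_comp_proj {f : T3 → ℝ} (hf : ContMDiff (𝓡 3) 𝓘(ℝ, ℝ) ∞ f) (y : E3) :
    DifferentiableAt ℝ (fun z => f (proj z)) y :=
  (hasFDerivAt_comp_proj hf y rfl).differentiableAt

theorem partialDeriv_proj {f : T3 → ℝ} (hf : ContMDiff (𝓡 3) 𝓘(ℝ, ℝ) ∞ f) (i : Fin 3) (y : E3) :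
    partialDeriv i f (proj y) = pderivE3 i (fun z => f (proj z)) y := by
  rw [pderivE3, (hasFDerivAt_comp_proj hf y rfl).fderiv]
  rfl

theorem chartVec_eq (x₀ : T3) (i : Fin 3) (y : E3) :
    (chartVec x₀ i y : E3) = EuclideanSpace.single i (1 : ℝ) :=
  congrArg (fun L : E3 →L[ℝ] E3 => L (EuclideanSpace.single i (1 : ℝ)))
    (mfderiv_extChartAt_symm x₀ y)

theorem endoCoord_eq (K : ∀ x : T3, TangentSpace (𝓡 3) x →L[ℝ] TangentSpace (𝓡 3) x) (x₀ : T3)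
    (j i : Fin 3) {y : E3} (hy : y ∈ (extChartAt (𝓡 3) x₀).target) :
    endoCoord K x₀ j i y
      = (EuclideanSpace.proj i : E3 →L[ℝ] ℝ) (K (proj y) (EuclideanSpace.single j (1 : ℝ) : E3)) := by
  have hs : (extChartAt (𝓡 3) x₀).symm y ∈ (chartAt E3 x₀).source := by
    have := (extChartAt (𝓡 3) x₀).map_target hy
    rwa [extChartAt_source] at this
  rw [endoCoord]
  erw [mfderiv_extChartAt hs, chartVec_eq]
  rw [extChartAt_symm_eq_proj]
  rfl

theorem metricCoord_eq (h : ∀ x : T3, TangentSpace (𝓡 3) x →L[ℝ] TangentSpace (𝓡 3) x →L[ℝ] ℝ)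
    (x₀ : T3) (i j : Fin 3) (y : E3) :
    metricCoord h x₀ y i j = h (proj y) (EuclideanSpace.single i (1 : ℝ) : E3)
      (EuclideanSpace.single j (1 : ℝ) : E3) := by
  rw [metricCoord, Matrix.of_apply]
  erw [chartVec_eq, chartVec_eq]
  rw [extChartAt_symm_eq_proj]

end T3

/-- The Christoffel terms in the divergence of a symmetric `(1,1)`-tensor field; `G` stands for the
inverse of the metric, and `D k i l` for the derivative `∂_k` of its component `(i, l)`. -/
theorem sum_christoffel_terms {G K : Fin 3 → Fin 3 → ℝ} {D : Fin 3 → Fin 3 → Fin 3 → ℝ}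
    (hG : ∀ i l, G i l = G l i) (hD : ∀ k i l, D k i l = D k l i)
    (hK : ∀ i l, ∑ k, G k l * K k i = ∑ k, G k i * K k l) (j : Fin 3) :
    ∑ i, ∑ k, ((1 / 2 * ∑ l, G i l * (D i k l + D k i l - D l i k)) * K j k
      - (1 / 2 * ∑ l, G k l * (D i j l + D j i l - D l i j)) * K k i)
    = 1 / 2 * ∑ k, K j k * (∑ i, ∑ l, G i l * D k i l)
      - 1 / 2 * ∑ i, ∑ l, (∑ k, G k l * K k i) * D j i l := by
  -- The difference is antisymmetric in `i, l`, so its contraction with the symmetric `G` vanishes;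
  -- `h2` is the same for `G` contracted with `K`, symmetric by `hK`.
  have h1 : ∀ k, ∑ i, ∑ l, G i l * (D i k l - D l i k) = 0 := by
    intro k
    have : ∑ i, ∑ l, G i l * D l i k = ∑ i, ∑ l, G i l * D i k l := by
      rw [Finset.sum_comm]
      exact Finset.sum_congr rfl fun i _ => Finset.sum_congr rfl fun l _ => by
        rw [hG l i, hD i l k]
    simp only [mul_sub, Finset.sum_sub_distrib, this, sub_self]
  have h2 : ∑ i, ∑ l, (∑ k, G k l * K k i) * (D i j l - D l i j) = 0 := by
    have : ∑ i, ∑ l, (∑ k, G k l * K k i) * D l i j = ∑ i, ∑ l, (∑ k, G k l * K k i) * D i j l := by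
      rw [Finset.sum_comm]
      exact Finset.sum_congr rfl fun i _ => Finset.sum_congr rfl fun l _ => by
        rw [hK l i, hD i l j]
    simp only [mul_sub, Finset.sum_sub_distrib, this, sub_self]
  have h3 := h1 0
  have h4 := h1 1
  have h5 := h1 2
  simp only [Fin.sum_univ_three] at h2 h3 h4 h5 ⊢
  linear_combination (1 / 2 * K j 0) * h3 + (1 / 2 * K j 1) * h4 + (1 / 2 * K j 2) * h5 - 1 / 2 * h2

/-! ### The divergence of `𝒦` -/

section Divergence

variable (c : Fin 3 → Fin 3 → T3 → ℝ) (p : Fin 3 → T3 → ℝ)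

theorem falYFlat_single (A i : Fin 3) (x : T3) :
    falYFlat c p A x (EuclideanSpace.single i 1) = falYCoord c p A i x := by
  simp [falYFlat_apply]

theorem metricCoord_falMetric (x₀ : T3) (i j : Fin 3) (y : E3) :
    metricCoord (falMetric c p) x₀ y i j = ∑ A, c A A (T3.proj y)
      * (falYCoord c p A i (T3.proj y) * falYCoord c p A j (T3.proj y)) := by
  rw [T3.metricCoord_eq]
  refine (falMetricFlat_apply c p _ _ _).trans ?_
  simp only [falYFlat_single]

theorem endoCoord_falK (x₀ : T3) (j i : Fin 3) {y : E3} (hy : y ∈ (extChartAt (𝓡 3) x₀).target) :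
    endoCoord (falK c p) x₀ j i y = falKCoord c p j i (T3.proj y) := by
  rw [T3.endoCoord_eq _ _ _ _ hy]
  refine (falKFlat_apply c p _ (EuclideanSpace.single j (1 : ℝ)) i).trans ?_
  simp

/-- Only entries strictly below the diagonal vary, so all other derivatives of the co-frame vanish.
-/
theorem falYCoord_of_le {A i : Fin 3} (h : A ≤ i) :
    falYCoord c p A i = fun _ => if A = i then 1 else 0 := by
  funext x
  fin_cases A <;> fin_cases i <;> simp_all [falYCoord]

end Divergence

namespace IsFournodavlosLukData

variable {c : Fin 3 → Fin 3 → T3 → ℝ} {p : Fin 3 → T3 → ℝ} (hd : IsFournodavlosLukData c p)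
include hd

theorem inv_metricCoord_falMetric (x₀ : T3) (i j : Fin 3) (y : E3) :
    (metricCoord (falMetric c p) x₀ y)⁻¹ i j = ∑ A, (c A A (T3.proj y))⁻¹
      * (falXCoord c p A i (T3.proj y) * falXCoord c p A j (T3.proj y)) := by
  have h : metricCoord (falMetric c p) x₀ y * Matrix.of (fun i j => ∑ A, (c A A (T3.proj y))⁻¹
      * (falXCoord c p A i (T3.proj y) * falXCoord c p A j (T3.proj y))) = 1 := by
    have h0 := (hd.pos 0 (T3.proj y)).ne'
    have h1 := (hd.pos 1 (T3.proj y)).ne'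
    have h2 := (hd.pos 2 (T3.proj y)).ne'
    ext i j
    simp only [Matrix.mul_apply, metricCoord_falMetric, Matrix.of_apply, Fin.sum_univ_three]
    fin_cases i <;> fin_cases j <;> simp [falXCoord, falYCoord] <;> field_simp <;> ring
  rw [Matrix.inv_eq_right_inv h]
  rfl

/-- The derivative of the metric in the direction `∂_k`, contracted with `X̄_A ⊗ X̄_A`. -/
theorem sum_pderivE3_metricCoord (x₀ : T3) (A k : Fin 3) (y : E3) :
    ∑ i, ∑ l, falXCoord c p A i (T3.proj y) * falXCoord c p A l (T3.proj y)
      * pderivE3 k (fun z => metricCoord (falMetric c p) x₀ z i l) y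
    = T3.partialDeriv k (c A A) (T3.proj y) := by
  have hc := fun A => T3.differentiableAt_comp_proj (hd.smooth_c A A) y
  have hY := fun A i => T3.differentiableAt_comp_proj (hd.contMDiff_falYCoord A i) y
  have hD : ∀ i l, pderivE3 k (fun z => metricCoord (falMetric c p) x₀ z i l) y
      = ∑ B, (pderivE3 k (fun z => c B B (T3.proj z)) y
          * (falYCoord c p B i (T3.proj y) * falYCoord c p B l (T3.proj y))
        + c B B (T3.proj y) * (pderivE3 k (fun z => falYCoord c p B i (T3.proj z)) y
            * falYCoord c p B l (T3.proj y)
          + falYCoord c p B i (T3.proj y)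
            * pderivE3 k (fun z => falYCoord c p B l (T3.proj z)) y)) := by
    intro i l
    simp only [metricCoord_falMetric]
    rw [pderivE3_fun_sum k fun B => (hc B).fun_mul ((hY B i).fun_mul (hY B l))]
    refine Finset.sum_congr rfl fun B _ => ?_
    refine (pderivE3_mul k (hc B) ((hY B i).fun_mul (hY B l))).trans ?_
    rw [pderivE3_mul k (hY B i) (hY B l)]
  -- By duality only `B = A` survives, and then `(∂_k Ȳ^A)(X̄_A) = 0`: the derivative is supported
  -- on `i < A` and `X̄_A` on `i ≥ A`.
  have h0 : ∀ B i, B ≤ i → pderivE3 k (fun z => falYCoord c p B i (T3.proj z)) y = 0 := by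
    intro B i hBi
    rw [falYCoord_of_le c p hBi]
    exact pderivE3_const k _ y
  rw [T3.partialDeriv_proj (hd.smooth_c A A)]
  simp only [hD, Fin.sum_univ_three, h0 0 0 (by decide), h0 0 1 (by decide), h0 0 2 (by decide),
    h0 1 1 (by decide), h0 1 2 (by decide), h0 2 2 (by decide)]
  fin_cases A <;> simp [falXCoord, falYCoord] <;> ring

theorem divergence_eq (x : T3) (j : Fin 3) :
    divergence (falMetric c p) (falK c p) x j
      = ∑ i, T3.partialDeriv i (falKCoord c p j i) x
        + 1 / 2 * ∑ k, falKCoord c p j k x * ∑ A, T3.partialDeriv k (c A A) x / c A A x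
        - 1 / 2 * ∑ A, p A x * (T3.partialDeriv j (c A A) x / c A A x) := by
  have hx : T3.proj (extChartAt (𝓡 3) x x) = x := T3.proj_extChartAt (mem_chart_source E3 x)
  set y := extChartAt (𝓡 3) x x with hy
  have hyt : y ∈ (extChartAt (𝓡 3) x).target := mem_extChartAt_target x
  have hK : ∀ k i, endoCoord (falK c p) x k i y = falKCoord c p k i x := fun k i => by
    rw [endoCoord_falK c p x k i hyt, hx]
  have hdK : ∀ i, pderivE3 i (endoCoord (falK c p) x j i) y
      = T3.partialDeriv i (falKCoord c p j i) x := by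
    intro i
    rw [← hx, T3.partialDeriv_proj (hd.contMDiff_falKCoord j i), hx]
    -- The component formula holds only on the chart target, which suffices since the target is a
    -- neighbourhood.
    refine congrArg (fun L : E3 →L[ℝ] ℝ => L _) (EventuallyEq.fderiv_eq ?_)
    filter_upwards [extChartAt_target_mem_nhds (I := 𝓡 3) x] with z hz
    exact endoCoord_falK c p x j i hz
  have hG : ∀ i l, (metricCoord (falMetric c p) x y)⁻¹ i l
      = ∑ A, (c A A x)⁻¹ * (falXCoord c p A i x * falXCoord c p A l x) := fun i l => by
    rw [hd.inv_metricCoord_falMetric, hx]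
  set D : Fin 3 → Fin 3 → Fin 3 → ℝ := fun k i l =>
    pderivE3 k (fun z => metricCoord (falMetric c p) x z i l) y with hDdef
  have hX : ∀ A k, ∑ i, ∑ l, falXCoord c p A i x * falXCoord c p A l x * D k i l
      = T3.partialDeriv k (c A A) x := fun A k => by
    have := hd.sum_pderivE3_metricCoord x A k y
    rwa [hx] at this
  have hKX : ∀ A i, ∑ k, falXCoord c p A k x * falKCoord c p k i x = p A x * falXCoord c p A i x := by
    intro A i
    have := congrArg (fun v : E3 => v i) (hd.falKFlat_falX A x)
    simp only [falKFlat_apply, falX, PiLp.smul_apply, smul_eq_mul] at this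
    rw [← this]
    exact Finset.sum_congr rfl fun k _ => mul_comm _ _
  -- Raising an index of `𝒦` gives `∑ c_{AA}⁻¹ p_A X̄_A ⊗ X̄_A`, visibly symmetric.
  have hGK : ∀ i l, ∑ k, (∑ A, (c A A x)⁻¹ * (falXCoord c p A k x * falXCoord c p A l x))
      * falKCoord c p k i x
      = ∑ A, (c A A x)⁻¹ * p A x * (falXCoord c p A i x * falXCoord c p A l x) := by
    intro i l
    simp only [Finset.sum_mul]
    rw [Finset.sum_comm]
    refine Finset.sum_congr rfl fun A _ => ?_
    rw [mul_assoc, ← mul_assoc (p A x), ← hKX, Finset.sum_mul, Finset.mul_sum]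
    exact Finset.sum_congr rfl fun k _ => by ring
  have hcontr : ∀ (w : Fin 3 → ℝ) (k : Fin 3),
      ∑ i, ∑ l, (∑ A, w A * (falXCoord c p A i x * falXCoord c p A l x)) * D k i l
      = ∑ A, w A * T3.partialDeriv k (c A A) x := by
    intro w k
    simp only [← hX, Fin.sum_univ_three]
    ring
  have hmain := sum_christoffel_terms (D := D)
    (G := fun i l => ∑ A, (c A A x)⁻¹ * (falXCoord c p A i x * falXCoord c p A l x))
    (K := fun k i => falKCoord c p k i x)
    (fun i l => Finset.sum_congr rfl fun A _ => by ring)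
    (fun k i l => by
      simp only [hDdef, metricCoord_falMetric, mul_comm (falYCoord c p _ i _)])
    (fun i l => by
      rw [hGK, hGK]
      exact Finset.sum_congr rfl fun A _ => by ring) j
  simp only [hGK, hcontr] at hmain
  change ∑ i, (pderivE3 i (endoCoord (falK c p) x j i) y
    + ∑ k, (christoffel (falMetric c p) x i i k y * endoCoord (falK c p) x j k y
      - christoffel (falMetric c p) x k i j y * endoCoord (falK c p) x k i y)) = _
  rw [Finset.sum_add_distrib]
  simp only [hK, hdK, christoffel, hG]
  rw [add_sub_assoc]
  refine congrArg (_ + ·) (hmain.trans ?_)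
  simp only [Fin.sum_univ_three]
  ring

theorem divergence_eq_zero (x : T3) (j : Fin 3) :
    divergence (falMetric c p) (falK c p) x j = 0 := by
  rw [hd.divergence_eq]
  have hx := T3.surjective_proj x
  obtain ⟨y, rfl⟩ := hx
  have hc := fun A => T3.differentiableAt_comp_proj (hd.smooth_c A A) y
  have hneg : ∀ l, T3.partialDeriv l (falKappa c p j l) (T3.proj y)
      = -T3.partialDeriv l (falKCoord c p j l) (T3.proj y) := by
    intro l
    rw [T3.partialDeriv_proj (hd.contMDiff_falKappa j l),
      T3.partialDeriv_proj (hd.contMDiff_falKCoord j l)]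
    simp only [falKCoord, pderivE3_neg, neg_neg]
  -- Logarithmic derivative of the product of the `c_{AA}`.
  have hprod : ∀ l, T3.partialDeriv l (fun y => c 0 0 y * c 1 1 y * c 2 2 y) (T3.proj y)
      / (c 0 0 (T3.proj y) * c 1 1 (T3.proj y) * c 2 2 (T3.proj y))
      = ∑ A, T3.partialDeriv l (c A A) (T3.proj y) / c A A (T3.proj y) := by
    intro l
    have h0 := (hd.pos 0 (T3.proj y)).ne'
    have h1 := (hd.pos 1 (T3.proj y)).ne'
    have h2 := (hd.pos 2 (T3.proj y)).ne'
    rw [T3.partialDeriv_proj (f := fun y => c 0 0 y * c 1 1 y * c 2 2 y)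
      (((hd.smooth_c 0 0).mul (hd.smooth_c 1 1)).mul (hd.smooth_c 2 2)),
      pderivE3_mul l ((hc 0).fun_mul (hc 1)) (hc 2), pderivE3_mul l (hc 0) (hc 1)]
    simp only [Fin.sum_univ_three, T3.partialDeriv_proj (hd.smooth_c _ _)]
    field_simp
  have hcon := hd.constraint j (T3.proj y)
  simp only [hneg, hprod] at hcon
  have hkap : ∀ l, falKappa c p j l (T3.proj y) = -falKCoord c p j l (T3.proj y) := fun l => by
    rw [falKCoord, neg_neg]
  simp only [hkap] at hcon
  -- The diagonal entry `𝒦_j{}^j = p_j` supplies the `-p_j` in the factor `p_l - p_j`; the entries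
  -- with `l > j` match the indicator term.
  fin_cases j <;>
  · simp [Fin.sum_univ_three, falKCoord_self,
      falKCoord_of_lt c p (show (0 : Fin 3) < 1 by decide),
      falKCoord_of_lt c p (show (0 : Fin 3) < 2 by decide),
      falKCoord_of_lt c p (show (1 : Fin 3) < 2 by decide)] at hcon ⊢
    linear_combination (-1 / 2) * hcon

end IsFournodavlosLukData

end

theorem mainTheorem9 (c : Fin 3 → Fin 3 → T3 → ℝ) (p : Fin 3 → T3 → ℝ)
    (hdata : IsFournodavlosLukData c p) :
    IsNondegenerateQuiescentVacuumData (M := T3) (falMetric c p) (falK c p) where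
  metric := hdata.isSmoothRiemannianMetric_falMetric
  smooth := hdata.isSmoothEndoField_falK
  trace_eq_one := hdata.trace_falKFlat
  symmetric := hdata.falMetricFlat_falKFlat
  trace_sq_eq_one := hdata.trace_falKFlat_sq
  div_eq_zero := hdata.divergence_eq_zero
  distinct_eigenvalues := hdata.ncard_eigenvalues
  exists_eigenframe x := ⟨univ, p, _, isOpen_univ, mem_univ x, hdata.isUnitEigenframeOn⟩
  structure_sq_eq_zero U q X γ hU hX hγ x hx := by
    rw [hdata.structureCoeff_eq_zero hU hX hγ hx, sq, mul_zero]
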